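/- Let $R=\mathbb{C}[[t]]$, $K=\mathbb{C}((t))$ and $R_n=\mathbb{C}[t]/(t^{n+1})=R/(t^{n+1})$. Let $X$ be a smooth projective variety over $\mathbb{C}$, and let $\pi:\mathcal{X}\to\mathrm{Spf}(R)$ be a formal deformation of $X$, i.e. a smooth and proper formal $R$-scheme with special fibre $X$, given by an inductive system of smooth and proper schemes $\pi_n:\mathcal{X}_n\to\mathrm{Spec}(R_n)$ with $\mathcal{X}_{n+1}\times_{\mathrm{Spec}(R_{n+1})}\mathrm{Spec}(R_n)\cong\mathcal{X}_n$ and $\mathcal{X}_0\cong X$. Let $\mathbf{Coh}(\mathcal{X})$ be the abelian category of coherent sheaves on $\mathcal{X}$, let $\mathbf{Coh}(\mathcal{X})_0\subset\mathbf{Coh}(\mathcal{X})$ be the Serre subcategory of the sheaves $E$ with $t^{n+1}E=0$ for some $n\geq 0$, and let $\mathbf{Coh}(\mathcal{X}_K)=\mathbf{Coh}(\mathcal{X})/\mathbf{Coh}(\mathcal{X})_0$ be the Serre quotient (the category of coherent sheaves on the "general fibre" of $\mathcal{X}$). Let $D^b_0(\mathbf{Coh}(\mathcal{X}))\subset D^b(\mathbf{Coh}(\mathcal{X}))$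 be the full triangulated subcategory of complexes with cohomology in $\mathbf{Coh}(\mathcal{X})_0$, and let $D^b(\mathcal{X}_K^c)=D^b(\mathbf{Coh}(\mathcal{X}))/D^b_0(\mathbf{Coh}(\mathcal{X}))$ be the Verdier quotient. **Proposition.** The natural exact functor $$Q:D^b(\mathbf{Coh}(\mathcal{X}))\to D^b(\mathbf{Coh}(\mathcal{X}_K))$$ (the termwise application of the quotient functor $\mathbf{Coh}(\mathcal{X})\to\mathbf{Coh}(\mathcal{X}_K)$) induces an exact equivalence $$D^b(\mathcal{X}_K^c)=D^b(\mathbf{Coh}(\mathcal{X}))/D^b_0(\mathbf{Coh}(\mathcal{X}))\;\xrightarrow{\ \sim\ }\;D^b(\mathbf{Coh}(\mathcal{X}_K)).$$ That is, there is an exact functor $\Phi$ from the Verdier quotient to $D^b(\mathbf{Coh}(\mathcal{X}_K))$ which is an equivalence of categories and whose composition with the quotient functor $D^b(\mathbf{Coh}(\mathcal{X}))\to D^b(\mathcal{X}_K^c)$ is isomorphic to $Q$, compatibly with shifts. -/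

import Mathlib

open CategoryTheory Limits ZeroObject TopologicalSpace Opposite AlgebraicGeometry

noncomputable section

namespace FormalCoh

universe u

variable {X : TopCat.{u}} {O : Sheaf (Opens.grothendieckTopology X) RingCat.{u}}

/-- The sections of a sheaf of `O`-modules over an open subset. -/
abbrev Sec (M : SheafOfModules.{u} O) (U : Opens X) : Type u := M.val.obj (op U)
/-- The sections of the structure sheaf over an open subset. -/
abbrev Fn (O : Sheaf (Opens.grothendieckTopology X) RingCat.{u}) (U : Opens X) : Type u :=
  O.obj.obj (op U)

/-- Restriction of sections of a sheaf of modules. -/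
def res (M : SheafOfModules.{u} O) {U V : Opens X} (h : V ≤ U) : Sec M U →+ Sec M V :=
  AddMonoidHom.mk' (fun m => M.val.map (homOfLE h).op m)
    (fun a b => map_add (M.val.map (homOfLE h).op).hom a b)
/-- Restriction of sections of the structure sheaf. -/
def fres (O : Sheaf (Opens.grothendieckTopology X) RingCat.{u}) {U V : Opens X} (h : V ≤ U) :
    Fn O U →+* Fn O V :=
  (O.obj.map (homOfLE h).op).hom

/-- The `O(U)`-linear map on sections over `U` of a morphism of sheaves of modules. -/
def app {M N : SheafOfModules.{u} O} (f : M ⟶ N) (U : Opens X) : Sec M U →ₗ[Fn O U] Sec N U :=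
  (f.val.app (op U)).hom

section
variable (M : SheafOfModules.{u} O) {U V W : Opens X}

lemma res_smul (h : V ≤ U) (a : Fn O U) (m : Sec M U) :
    res M h (a • m) = fres O h a • res M h m := M.val.map_smul _ _ _
lemma res_res (h : V ≤ U) (h' : W ≤ V) (m : Sec M U) :
    res M h' (res M h m) = res M (h'.trans h) m :=
  (M.val.map_comp_apply (homOfLE h).op (homOfLE h').op m).symm
lemma res_rfl (h : U ≤ U) (m : Sec M U) : res M h m = m := by
  change M.val.map (𝟙 (op U)) m = m
  rw [M.val.map_id]; rfl
lemma fres_fres (h : V ≤ U) (h' : W ≤ V) (m : Fn O U) :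
    fres O h' (fres O h m) = fres O (h'.trans h) m := by
  unfold fres
  rw [← RingHom.comp_apply, ← RingCat.hom_comp, ← O.obj.map_comp]; rfl
lemma res_sum_smul {ι : Type} [Fintype ι] (h : V ≤ U) (a : ι → Fn O U) (m : ι → Sec M U) :
    res M h (∑ i, a i • m i) = ∑ i, fres O h (a i) • res M h (m i) := by
  rw [map_sum]; simp only [res_smul]
lemma app_res {M N : SheafOfModules.{u} O} (f : M ⟶ N) (h : V ≤ U) (m : Sec M U) :
    app f V (res M h m) = res N h (app f U m) :=
  PresheafOfModules.naturality_apply f.val (homOfLE h).op m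
end

lemma app_injective {M N : SheafOfModules.{u} O} (f : M ⟶ N) [Mono f] (U : Opens X) :
    Function.Injective (app f U) := by
  have : Mono ((SheafOfModules.forget O).map f) := inferInstance
  exact PresheafOfModules.injective_of_mono ((SheafOfModules.forget O).map f) (op U)

lemma exists_app_eq (S : ShortComplex (SheafOfModules.{u} O)) (hS : S.Exact) [Mono S.f]
    (U : Opens X) (m : Sec S.X₂ U) (hm : app S.g U m = 0) : ∃ k, app S.f U k = m := by
  have : (SheafOfModules.evaluation O (op U)).PreservesZeroMorphisms := ⟨fun _ _ => rfl⟩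
  have := hS.map_of_mono_of_preservesKernel (SheafOfModules.evaluation O (op U)) inferInstance
    inferInstance
  rw [ShortComplex.moduleCat_exact_iff] at this
  exact this m hm

lemma locally_exists_app_eq {M N : SheafOfModules.{u} O} (f : M ⟶ N) [Epi f] (U : Opens X)
    (n : Sec N U) (x : X) (hx : x ∈ U) :
    ∃ (V : Opens X) (h : V ≤ U), x ∈ V ∧ ∃ m : Sec M V, app f V m = res N h n := by
  let q := cokernel.π f.val
  let η := (PresheafOfModules.sheafificationAdjunction (𝟙 O.obj)).unit.app (cokernel f.val)
  have hq : q ≫ η = 0 := by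
    let g : N ⟶ (PresheafOfModules.sheafification (𝟙 O.obj)).obj (cokernel f.val) := ⟨q ≫ η⟩
    have : f ≫ g = 0 := by
      apply SheafOfModules.hom_ext
      change f.val ≫ q ≫ η = 0
      simp [q]
    have : g = 0 := by rwa [← cancel_epi f, comp_zero]
    exact congr_arg SheafOfModules.Hom.val this
  have h0 : (CategoryTheory.toSheafify (Opens.grothendieckTopology X)
      (cokernel f.val).presheaf).app (op U) (q.app (op U) n) =
        (CategoryTheory.toSheafify (Opens.grothendieckTopology X)
      (cokernel f.val).presheaf).app (op U) 0 := by
    have h1 : (q ≫ η).app (op U) n = 0 := by rw [hq]; rfl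
    rw [map_zero]
    exact h1
  have inj := Presheaf.equalizerSieve_mem (Opens.grothendieckTopology X)
    (CategoryTheory.toSheafify (Opens.grothendieckTopology X) (cokernel f.val).presheaf)
    (q.app (op U) n) 0 h0
  obtain ⟨V, i, hi, hxV⟩ := inj x hx
  have hi' : (cokernel f.val).map i.op (q.app (op U) n) = 0 := by
    refine Eq.trans hi ?_
    exact map_zero ((cokernel f.val).presheaf.map i.op).hom
  rw [← PresheafOfModules.naturality_apply] at hi'
  have hex : (ShortComplex.mk f.val q (by simp [q])).Exact :=
    ShortComplex.exact_cokernel f.val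
  have := hex.map_of_epi_of_preservesCokernel (PresheafOfModules.evaluation O.obj (op V)) inferInstance
    inferInstance
  rw [ShortComplex.moduleCat_exact_iff] at this
  obtain ⟨m, hm⟩ := this (N.val.map i.op n) hi'
  exact ⟨V, i.le, hxV, m, hm⟩

lemma locally_exists_app_eq' (S : ShortComplex (SheafOfModules.{u} O)) (hS : S.Exact)
    (U : Opens X) (m : Sec S.X₂ U) (hm : app S.g U m = 0) (x : X) (hx : x ∈ U) :
    ∃ (V : Opens X) (h : V ≤ U), x ∈ V ∧ ∃ k : Sec S.X₁ V, app S.f V k = res S.X₂ h m := by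
  have := hS.epi_kernelLift
  obtain ⟨k, hk⟩ := exists_app_eq (ShortComplex.mk (kernel.ι S.g) S.g (by simp))
    (ShortComplex.exact_kernel S.g) U m hm
  obtain ⟨V, h, hxV, l, hl⟩ := locally_exists_app_eq (kernel.lift S.g S.f S.zero) U k x hx
  refine ⟨V, h, hxV, l, ?_⟩
  have h2 : app S.f V l = app (kernel.ι S.g) V (app (kernel.lift S.g S.f S.zero) V l) := by
    conv_lhs => rw [← kernel.lift_ι S.g S.f S.zero]
    rfl
  rw [h2, hl, app_res]
  exact congrArg _ hk

/-- The sections `s i` over `U` generate `M` on `U`: the morphism `O^ι → M` over `U` which they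
define is an epimorphism of sheaves, i.e. every section of `M` over an open `V ≤ U` is locally an
`O`-linear combination of them. -/
def Generates (M : SheafOfModules.{u} O) {U : Opens X} {ι : Type} [Fintype ι]
    (s : ι → Sec M U) : Prop :=
  ∀ (V : Opens X) (h : V ≤ U) (m : Sec M V), ∀ x ∈ V,
    ∃ (W : Opens X) (h' : W ≤ V), x ∈ W ∧
      ∃ a : ι → Fn O W, res M h' m = ∑ i, a i • res M (h'.trans h) (s i)

/-- `M` is a sheaf of modules of finite type: locally generated by finitely many sections. -/
def IsFiniteType (M : SheafOfModules.{u} O) : Prop :=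
  ∀ x : X, ∃ U : Opens X, x ∈ U ∧ ∃ (n : ℕ) (s : Fin n → Sec M U), Generates M s

/-- The `r k` are relations between the sections `s i` over `U`, and they generate the sheaf of
relations, i.e. the kernel of the morphism `O^ι → M` over `U` defined by the `s i`. -/
def GeneratesRelations (M : SheafOfModules.{u} O) {U : Opens X} {ι κ : Type} [Fintype ι]
    [Fintype κ] (s : ι → Sec M U) (r : κ → ι → Fn O U) : Prop :=
  (∀ k, ∑ i, r k i • s i = 0) ∧
  ∀ (V : Opens X) (h : V ≤ U) (a : ι → Fn O V), ∑ i, a i • res M h (s i) = 0 → ∀ x ∈ V,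
    ∃ (W : Opens X) (h' : W ≤ V), x ∈ W ∧
      ∃ b : κ → Fn O W, ∀ i, fres O h' (a i) = ∑ k, b k * fres O (h'.trans h) (r k i)

/-- The sheaf of relations between the sections `s i` over `U` is of finite type. -/
def HasFiniteRelations (M : SheafOfModules.{u} O) {U : Opens X} {ι : Type} [Fintype ι]
    (s : ι → Sec M U) : Prop :=
  ∀ x ∈ U, ∃ (V : Opens X) (h : V ≤ U), x ∈ V ∧
    ∃ (m : ℕ) (r : Fin m → ι → Fn O V), GeneratesRelations M (fun i => res M h (s i)) r

/-- `M` is coherent: it is of finite type, and for every open `U` and every finite family of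
sections of `M` over `U` (i.e. every morphism `O^n → M` over `U`) the sheaf of relations (the
kernel of this morphism) is of finite type. -/
def IsCoherent (M : SheafOfModules.{u} O) : Prop :=
  IsFiniteType M ∧
    ∀ (U : Opens X) (n : ℕ) (s : Fin n → Sec M U), HasFiniteRelations M s

section
variable {M N K : SheafOfModules.{u} O} {U V W : Opens X}

lemma Generates.res {ι : Type} [Fintype ι] {s : ι → Sec M U} (hs : Generates M s) (h : V ≤ U) :
    Generates M (fun i => FormalCoh.res M h (s i)) := by
  intro W hW m x hx
  obtain ⟨W', h', hx', a, ha⟩ := hs W (hW.trans h) m x hx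
  exact ⟨W', h', hx', a, by simpa only [res_res] using ha⟩

lemma GeneratesRelations.res {ι κ : Type} [Fintype ι] [Fintype κ] {s : ι → Sec M U}
    {r : κ → ι → Fn O U} (hr : GeneratesRelations M s r) (h : V ≤ U) :
    GeneratesRelations M (fun i => FormalCoh.res M h (s i)) (fun k i => fres O h (r k i)) := by
  refine ⟨fun k => ?_, fun W hW a ha x hx => ?_⟩
  · rw [← res_sum_smul, hr.1 k, map_zero]
  · obtain ⟨W', h', hx', b, hb⟩ := hr.2 W (hW.trans h) a (by simpa only [res_res] using ha) x hx
    exact ⟨W', h', hx', b, by simpa only [fres_fres] using hb⟩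

lemma isFiniteType_of {M : SheafOfModules.{u} O}
    (h : ∀ x : X, ∃ U : Opens X, x ∈ U ∧ ∃ (ι : Type) (_ : Fintype ι) (s : ι → Sec M U),
      Generates M s) : IsFiniteType M := by
  intro x
  obtain ⟨U, hx, ι, _, s, hs⟩ := h x
  refine ⟨U, hx, Fintype.card ι, s ∘ (Fintype.equivFin ι).symm, fun V hV m y hy => ?_⟩
  obtain ⟨W, h', hy', a, ha⟩ := hs V hV m y hy
  refine ⟨W, h', hy', a ∘ (Fintype.equivFin ι).symm, ha.trans ?_⟩
  exact ((Fintype.equivFin ι).symm.sum_comp (fun i => a i • FormalCoh.res M _ (s i))).symm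

lemma hasFiniteRelations_of {ι : Type} [Fintype ι] {s : ι → Sec M U}
    (h : ∀ x ∈ U, ∃ (V : Opens X) (h : V ≤ U), x ∈ V ∧
      ∃ (κ : Type) (_ : Fintype κ) (r : κ → ι → Fn O V),
        GeneratesRelations M (fun i => FormalCoh.res M h (s i)) r) : HasFiniteRelations M s := by
  intro x hx
  obtain ⟨V, hV, hxV, κ, _, r, hr⟩ := h x hx
  refine ⟨V, hV, hxV, Fintype.card κ, fun k => r ((Fintype.equivFin κ).symm k),
    fun k => hr.1 _, fun W hW a ha y hy => ?_⟩
  obtain ⟨W', h', hy', b, hb⟩ := hr.2 W hW a ha y hy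
  refine ⟨W', h', hy', b ∘ (Fintype.equivFin κ).symm, fun i => (hb i).trans ?_⟩
  exact ((Fintype.equivFin κ).symm.sum_comp (fun k => b k * fres O _ (r k i))).symm

lemma IsCoherent.hasFiniteRelations (hM : IsCoherent M) {ι : Type} [Fintype ι]
    (s : ι → Sec M U) : HasFiniteRelations M s := by
  intro x hx
  let e := Fintype.equivFin ι
  obtain ⟨V, hV, hxV, m, r, hr⟩ := hM.2 U _ (s ∘ e.symm) x hx
  refine ⟨V, hV, hxV, m, fun k i => r k (e i), fun k => ?_, fun W hW a ha y hy => ?_⟩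
  · rw [← hr.1 k, ← e.sum_comp]
    simp
  · obtain ⟨W', h', hy', b, hb⟩ := hr.2 W hW (a ∘ e.symm) (by
      rw [← ha, ← e.sum_comp]; simp) y hy
    exact ⟨W', h', hy', b, fun i => by simpa using hb (e i)⟩

lemma exists_common {ι : Type} [Fintype ι] (x : X) (U : Opens X) (hx : x ∈ U)
    (P : ι → Opens X → Prop) (hP : ∀ i V W, W ≤ V → P i V → P i W)
    (h : ∀ i, ∃ V : Opens X, V ≤ U ∧ x ∈ V ∧ P i V) :
    ∃ V : Opens X, V ≤ U ∧ x ∈ V ∧ ∀ i, P i V := by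
  choose V hVU hxV hV using h
  refine ⟨U ⊓ Finset.univ.inf V, inf_le_left, ⟨hx, ?_⟩, fun i => hP i (V i) _ ?_ (hV i)⟩
  · simp only [SetLike.mem_coe]
    rw [← SetLike.mem_coe, Opens.coe_finset_inf]
    simpa using hxV
  · exact inf_le_right.trans (Finset.inf_le (Finset.mem_univ i))

/-- finitely many sections lift locally along an epimorphism -/
lemma exists_lifts (f : M ⟶ N) [Epi f] {ι : Type} [Fintype ι] (n : ι → Sec N U) (x : X)
    (hx : x ∈ U) : ∃ (V : Opens X) (h : V ≤ U), x ∈ V ∧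
      ∃ m : ι → Sec M V, ∀ i, app f V (m i) = FormalCoh.res N h (n i) := by
  obtain ⟨V, hV, hxV, h⟩ := exists_common x U hx
    (fun i V => ∃ (h : V ≤ U) (m : Sec M V), app f V m = FormalCoh.res N h (n i))
    (fun i V W hWV => by
      rintro ⟨h, m, hm⟩
      exact ⟨hWV.trans h, FormalCoh.res M hWV m, by rw [app_res, hm, res_res]⟩)
    (fun i => by
      obtain ⟨V, h, hxV, m, hm⟩ := locally_exists_app_eq f U (n i) x hx
      exact ⟨V, h, hxV, h, m, hm⟩)
  choose h' m hm using h
  exact ⟨V, hV, hxV, m, hm⟩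

lemma app_sum_smul (f : M ⟶ N) {ι : Type} [Fintype ι] (a : ι → Fn O U) (m : ι → Sec M U) :
    app f U (∑ i, a i • m i) = ∑ i, a i • app f U (m i) := by
  simp only [map_sum, map_smul]

/-- a subsheaf of finite type of a coherent sheaf inherits finite relations -/
lemma hasFiniteRelations_of_mono (f : M ⟶ N) [Mono f] (hN : IsCoherent N) {ι : Type}
    [Fintype ι] (s : ι → Sec M U) : HasFiniteRelations M s := by
  intro x hx
  obtain ⟨V, hV, hxV, m, r, hr⟩ := hN.hasFiniteRelations (fun i => app f U (s i)) x hx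
  refine ⟨V, hV, hxV, m, r, fun k => app_injective f V ?_, fun W hW a ha y hy => ?_⟩
  · rw [app_sum_smul, map_zero, ← hr.1 k]
    simp only [app_res]
  · refine hr.2 W hW a ?_ y hy
    have := congrArg (app f W) ha
    rw [app_sum_smul, map_zero] at this
    rw [← this]
    simp only [app_res]

/-- kernels -/
lemma isCoherent_kernel {S : ShortComplex (SheafOfModules.{u} O)} (hS : S.Exact) [Mono S.f]
    (h₂ : IsCoherent S.X₂) (h₃ : IsCoherent S.X₃) : IsCoherent S.X₁ := by
  refine ⟨fun x => ?_, fun U n s => hasFiniteRelations_of_mono S.f h₂ s⟩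
  obtain ⟨U, hxU, n, s, hs⟩ := h₂.1 x
  obtain ⟨V, hV, hxV, m, r, hr⟩ := h₃.hasFiniteRelations (fun i => app S.g U (s i)) x hxU
  have key : ∀ k, ∃ t : Sec S.X₁ V, app S.f V t = ∑ i, r k i • FormalCoh.res S.X₂ hV (s i) :=
    fun k => exists_app_eq S hS V _ (by
      rw [app_sum_smul, ← hr.1 k]; simp only [app_res])
  choose t ht using key
  refine ⟨V, hxV, m, t, fun W hW k y hy => ?_⟩
  obtain ⟨W', hW', hy', a, ha⟩ := hs W (hW.trans hV) (app S.f W k) y hy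
  have h0 : ∑ i, a i • FormalCoh.res S.X₃ (hW'.trans hW)
      (FormalCoh.res S.X₃ hV (app S.g U (s i))) = 0 := by
    have h1 := congrArg (app S.g W') ha
    rw [app_sum_smul, app_res] at h1
    have h2 : app S.g W (app S.f W k) = 0 := by
      change app (S.f ≫ S.g) W k = 0
      rw [S.zero]; rfl
    rw [h2, map_zero] at h1
    rw [h1]
    simp only [app_res, res_res]
  obtain ⟨W'', hW'', hy'', b, hb⟩ := hr.2 W' (hW'.trans hW) a h0 y hy'
  refine ⟨W'', hW''.trans hW', hy'', b, app_injective S.f W'' ?_⟩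
  rw [app_sum_smul, app_res, ← res_res _ hW' hW'', ha, res_sum_smul]
  simp only [hb, app_res, ht, res_sum_smul, Finset.sum_smul, Finset.smul_sum, mul_smul, res_res]
  exact Finset.sum_comm

/-- cokernels -/
lemma isCoherent_cokernel {S : ShortComplex (SheafOfModules.{u} O)} (hS : S.Exact) [Epi S.g]
    (h₁ : IsCoherent S.X₁) (h₂ : IsCoherent S.X₂) : IsCoherent S.X₃ := by
  refine ⟨fun x => ?_, fun U n c => hasFiniteRelations_of fun x hx => ?_⟩
  · obtain ⟨U, hxU, n, s, hs⟩ := h₂.1 x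
    refine ⟨U, hxU, n, fun i => app S.g U (s i), fun V hV c y hy => ?_⟩
    obtain ⟨W, hW, hyW, m, hm⟩ := locally_exists_app_eq S.g V c y hy
    obtain ⟨W', hW', hyW', a, ha⟩ := hs W (hW.trans hV) m y hyW
    refine ⟨W', hW'.trans hW, hyW', a, ?_⟩
    rw [← res_res _ hW hW', ← hm, ← app_res, ha, app_sum_smul]
    simp only [app_res]
  · obtain ⟨V₁, hV₁, hx₁, t, ht⟩ := exists_lifts S.g c x hx
    obtain ⟨V₂, hx₂, l, s, hs⟩ := h₁.1 x
    let V := V₁ ⊓ V₂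
    have hVV₁ : V ≤ V₁ := inf_le_left
    have hVV₂ : V ≤ V₂ := inf_le_right
    let w : Fin n ⊕ Fin l → Sec S.X₂ V := Sum.elim (fun i => FormalCoh.res S.X₂ hVV₁ (t i))
      (fun j => app S.f V (FormalCoh.res S.X₁ hVV₂ (s j)))
    obtain ⟨V', hV', hxV', m, r, hr⟩ := h₂.hasFiniteRelations w x ⟨hx₁, hx₂⟩
    have zz : ∀ (W : Opens X) (k : Sec S.X₁ W), app S.g W (app S.f W k) = 0 := fun W k => by
      change app (S.f ≫ S.g) W k = 0
      rw [S.zero]; rfl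
    refine ⟨V', hV'.trans (hVV₁.trans hV₁), hxV', Fin m, inferInstance,
      fun k i => r k (Sum.inl i), fun k => ?_, fun W hW a ha y hy => ?_⟩
    · have h1 := congrArg (app S.g V') (hr.1 k)
      rw [app_sum_smul, Fintype.sum_sum_type, map_zero] at h1
      simp only [w, Sum.elim_inl, Sum.elim_inr, app_res, zz, map_zero, smul_zero,
        Finset.sum_const_zero, add_zero, ht, res_res] at h1
      exact h1
    · have h1 : app S.g W (∑ i, a i • FormalCoh.res S.X₂ (hW.trans (hV'.trans hVV₁)) (t i)) = 0 := by
        rw [app_sum_smul, ← ha]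
        simp only [app_res, ht, res_res]
      obtain ⟨W₁, hW₁, hy₁, k, hk⟩ := locally_exists_app_eq' S hS W _ h1 y hy
      obtain ⟨W₂, hW₂, hy₂, e, he⟩ := hs W₁ (hW₁.trans (hW.trans (hV'.trans hVV₂))) k y hy₁
      have hk2 := congrArg (FormalCoh.res S.X₂ hW₂) hk
      rw [← app_res, he, app_sum_smul, res_res, res_sum_smul] at hk2
      obtain ⟨W₃, hW₃, hy₃, b, hb⟩ := hr.2 W₂ (hW₂.trans (hW₁.trans hW))
        (Sum.elim (fun i => fres O (hW₂.trans hW₁) (a i)) (fun j => - e j)) (by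
          rw [Fintype.sum_sum_type]
          simp only [w, Sum.elim_inl, Sum.elim_inr, neg_smul, Finset.sum_neg_distrib]
          rw [add_neg_eq_zero]
          simp only [app_res, res_res] at hk2 ⊢
          exact hk2.symm) y hy₂
      refine ⟨W₃, hW₃.trans (hW₂.trans hW₁), hy₃, b, fun i => ?_⟩
      have := hb (Sum.inl i)
      simpa only [Sum.elim_inl, fres_fres] using this

/-- extensions -/
lemma isCoherent_extension {S : ShortComplex (SheafOfModules.{u} O)} (hS : S.ShortExact)
    (h₁ : IsCoherent S.X₁) (h₃ : IsCoherent S.X₃) : IsCoherent S.X₂ := by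
  have := hS.mono_f
  have := hS.epi_g
  refine ⟨isFiniteType_of fun x => ?_, fun U n s => hasFiniteRelations_of fun x hx => ?_⟩
  · obtain ⟨U₁, hx₁, n₁, s₁, hs₁⟩ := h₁.1 x
    obtain ⟨U₃, hx₃, n₃, s₃, hs₃⟩ := h₃.1 x
    obtain ⟨V₃, hV₃, hx₃', t, ht⟩ := exists_lifts S.g s₃ x hx₃
    refine ⟨U₁ ⊓ V₃, ⟨hx₁, hx₃'⟩, Fin n₁ ⊕ Fin n₃, inferInstance,
      Sum.elim (fun i => app S.f _ (FormalCoh.res S.X₁ inf_le_left (s₁ i)))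
        (fun j => FormalCoh.res S.X₂ inf_le_right (t j)), fun V hV m y hy => ?_⟩
    obtain ⟨W, hW, hyW, a, ha⟩ := hs₃ V (hV.trans (inf_le_right.trans hV₃)) (app S.g V m) y hy
    obtain ⟨k, hk⟩ := exists_app_eq S hS.exact W
      (FormalCoh.res S.X₂ hW m - ∑ j, a j • FormalCoh.res S.X₂ (hW.trans (hV.trans inf_le_right)) (t j)) (by
        rw [map_sub, app_sum_smul, app_res, ha, sub_eq_zero]
        simp only [app_res, ht, res_res])
    obtain ⟨W', hW', hyW', b, hb⟩ := hs₁ W (hW.trans (hV.trans inf_le_left)) k y hyW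
    refine ⟨W', hW'.trans hW, hyW', Sum.elim b (fun j => fres O hW' (a j)), ?_⟩
    have h1 := congrArg (FormalCoh.res S.X₂ hW') hk
    rw [map_sub, ← app_res, hb, app_sum_smul, res_res, res_sum_smul, eq_sub_iff_add_eq] at h1
    rw [Fintype.sum_sum_type, ← h1]
    simp only [Sum.elim_inl, Sum.elim_inr, app_res, res_res]
  · obtain ⟨V, hV, hxV, m, r, hr⟩ := h₃.hasFiniteRelations (fun i => app S.g U (s i)) x hx
    have key : ∀ k, ∃ t : Sec S.X₁ V, app S.f V t = ∑ i, r k i • FormalCoh.res S.X₂ hV (s i) :=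
      fun k => exists_app_eq S hS.exact V _ (by
        rw [app_sum_smul, ← hr.1 k]; simp only [app_res])
    choose t ht using key
    obtain ⟨V', hV', hxV', p, q, hq⟩ := h₁.hasFiniteRelations t x hxV
    have comb : ∀ (W : Opens X) (hW : W ≤ V) (b : Fin m → Fn O W),
        app S.f W (∑ j, b j • FormalCoh.res S.X₁ hW (t j)) =
          ∑ i, (∑ j, b j * fres O hW (r j i)) • FormalCoh.res S.X₂ (hW.trans hV) (s i) := by
      intro W hW b
      rw [app_sum_smul]
      simp only [app_res, ht, res_sum_smul, Finset.sum_smul, Finset.smul_sum, mul_smul, res_res]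
      exact Finset.sum_comm
    refine ⟨V', hV'.trans hV, hxV', Fin p, inferInstance,
      fun k i => ∑ j, q k j * fres O hV' (r j i), fun k => ?_, fun W hW a ha y hy => ?_⟩
    · rw [← comb V' hV' (q k), hq.1 k, map_zero]
    · obtain ⟨W₁, hW₁, hy₁, b, hb⟩ := hr.2 W (hW.trans hV') a (by
        have h1 := congrArg (app S.g W) ha
        rw [app_sum_smul, map_zero] at h1
        rw [← h1]
        simp only [app_res, res_res]) y hy
      have h2 : ∑ j, b j • FormalCoh.res S.X₁ (hW₁.trans hW) (FormalCoh.res S.X₁ hV' (t j)) = 0 := by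
        apply app_injective S.f W₁
        have h3 := congrArg (FormalCoh.res S.X₂ hW₁) ha
        rw [res_sum_smul, map_zero] at h3
        simp only [res_res, hb] at h3 ⊢
        rw [comb, map_zero, ← h3]
      obtain ⟨W₂, hW₂, hy₂, c, hc⟩ := hq.2 W₁ (hW₁.trans hW) b h2 y hy₁
      refine ⟨W₂, hW₂.trans hW₁, hy₂, c, fun i => ?_⟩
      rw [← fres_fres hW₁ hW₂, hb]
      simp only [map_sum, map_mul, hc, Finset.sum_mul, Finset.mul_sum, fres_fres, mul_assoc]
      exact Finset.sum_comm

lemma isCoherent_of_isZero (h : IsZero M) : IsCoherent M := by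
  have sub : ∀ (U : Opens X) (m : Sec M U), m = 0 := fun U m => by
    have : app (𝟙 M) U m = 0 := by
      rw [h.eq_of_src (𝟙 M) 0]; rfl
    exact this
  refine ⟨fun x => ⟨⊤, trivial, 0, Fin.elim0, fun V hV m y hy => ⟨V, le_rfl, hy, Fin.elim0, ?_⟩⟩,
    fun U n s => hasFiniteRelations_of fun x hx => ⟨U, le_rfl, hx, Fin n, inferInstance,
      fun k i => if k = i then 1 else 0, fun k => sub _ _,
      fun V hV a ha y hy => ⟨V, le_rfl, hy, a, fun i => ?_⟩⟩⟩
  · rw [sub V m, map_zero]; simp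
  · have : fres O (le_refl V) (a i) = a i := by
      unfold fres
      change (O.obj.map (𝟙 (op V))).hom (a i) = a i
      rw [O.obj.map_id]; rfl
    rw [this]
    simp [apply_ite]
end

variable (O) in
/-- The coherent sheaves of `O`-modules. -/
abbrev coherent : ObjectProperty (SheafOfModules.{u} O) := IsCoherent

instance : (coherent O).ContainsZero := ⟨⟨0, isZero_zero _, isCoherent_of_isZero (isZero_zero _)⟩⟩
instance : (coherent O).IsClosedUnderExtensions where
  prop_X₂_of_shortExact hS h₁ h₃ := isCoherent_extension hS h₁ h₃
instance : (coherent O).IsClosedUnderKernels where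
  kernels_le := by
    rintro _ ⟨f, k, hk, hf⟩
    have : Mono k.ι := Fork.IsLimit.mono hk
    exact isCoherent_kernel (S := ShortComplex.mk k.ι f (KernelFork.condition k))
      (ShortComplex.exact_of_f_is_kernel _ (IsLimit.ofIsoLimit hk (Fork.ext (Iso.refl _)))) hf.1 hf.2
instance : (coherent O).IsClosedUnderCokernels where
  cokernels_le := by
    rintro _ ⟨f, k, hk, hf⟩
    have : Epi k.π := Cofork.IsColimit.epi hk
    exact isCoherent_cokernel (S := ShortComplex.mk f k.π (CokernelCofork.condition k))
      (ShortComplex.exact_of_g_is_cokernel _ (IsColimit.ofIsoColimit hk (Cofork.ext (Iso.refl _)))) hf.1 hf.2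
instance : (coherent O).IsClosedUnderIsomorphisms where
  of_iso {M _} e hM :=
    isCoherent_kernel (S := ShortComplex.mk e.inv (0 : M ⟶ (0 : SheafOfModules.{u} O)) comp_zero)
      ((ShortComplex.exact_iff_epi _ rfl).2 inferInstance) hM
      (isCoherent_of_isZero (isZero_zero _))
instance : (coherent O).IsClosedUnderBinaryProducts where
  limitsOfShape_le := by
    rintro _ ⟨p⟩
    refine (coherent O).prop_of_iso ?_ ((coherent O).prop_biprod
      (p.prop_diag_obj (.mk .left)) (p.prop_diag_obj (.mk .right)))
    exact IsLimit.conePointUniqueUpToIso (BinaryBiproduct.isLimit _ _)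
      ((IsLimit.postcomposeHomEquiv (diagramIsoPair p.diag) _).2 p.isLimit)
instance : (coherent O).IsClosedUnderFiniteProducts := .mk'
instance : Abelian (coherent O).FullSubcategory := inferInstance

instance : PreservesFiniteLimits (coherent O).ι := by
  have := (coherent O).preservesKernels_ι
  exact Functor.preservesFiniteLimits_of_preservesKernels _
instance : PreservesFiniteColimits (coherent O).ι := by
  have := (coherent O).preservesCokernels_ι
  exact Functor.preservesFiniteColimits_of_preservesCokernels _

/-- The sheaves of modules annihilated by a power of the global function `t`. -/
def torsion (t : Fn O ⊤) : ObjectProperty (SheafOfModules.{u} O) := fun M =>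
  ∃ n : ℕ, ∀ (U : Opens X) (m : Sec M U), (fres O (le_top : U ≤ ⊤) t ^ (n + 1) : Fn O U) • m = 0

lemma eq_zero_of_locally (M : SheafOfModules.{u} O) (U : Opens X) (m : Sec M U)
    (h : ∀ x ∈ U, ∃ (V : Opens X) (hV : V ≤ U), x ∈ V ∧ res M hV m = 0) : m = 0 := by
  have hs := (Presieve.IsSheaf.isSeparated
    ((isSheaf_iff_isSheaf_of_type _ _).1
      (GrothendieckTopology.HasSheafCompose.isSheaf (J := Opens.grothendieckTopology X)
        (F := forget AddCommGrpCat.{u}) _ M.isSheaf)))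
  let S : Sieve U := ⟨fun V i => res M i.le m = 0, fun {V W} i h j => by
    rw [← res_res M i.le j.le, h, map_zero]⟩
  have hS : S ∈ Opens.grothendieckTopology X U := fun x hx => by
    obtain ⟨V, hV, hxV, hm⟩ := h x hx
    exact ⟨V, homOfLE hV, hm, hxV⟩
  refine (hs S hS).ext (t₁ := m) (t₂ := (0 : Sec M U)) fun V i hi => ?_
  exact Eq.trans (show _ = _ from hi) (map_zero (res M i.le)).symm

section
variable (t : Fn O ⊤)

lemma res_tpow {M : SheafOfModules.{u} O} {U V : Opens X} (h : V ≤ U) (n : ℕ) (m : Sec M U) :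
    res M h (fres O (le_top : U ≤ ⊤) t ^ n • m) = fres O (le_top : V ≤ ⊤) t ^ n • res M h m := by
  rw [res_smul, map_pow, fres_fres]

instance : (torsion t).IsSerreClass where
  exists_zero := ⟨0, isZero_zero _, 0, fun U m => by
    have h : app (𝟙 (0 : SheafOfModules.{u} O)) U (fres O (le_top : U ≤ ⊤) t ^ (0 + 1) • m) = 0 := by
      rw [(isZero_zero (SheafOfModules.{u} O)).eq_of_src (𝟙 _) 0]; rfl
    exact h⟩
  prop_of_mono {M N} f _ := by
    rintro ⟨n, hn⟩
    exact ⟨n, fun U m => app_injective f U (by rw [map_smul, hn, map_zero])⟩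
  prop_of_epi {M N} f _ := by
    rintro ⟨n, hn⟩
    refine ⟨n, fun U m => eq_zero_of_locally N U _ fun x hx => ?_⟩
    obtain ⟨V, hV, hxV, l, hl⟩ := locally_exists_app_eq f U m x hx
    exact ⟨V, hV, hxV, by rw [res_tpow, ← hl, ← map_smul, hn, map_zero]⟩
  prop_X₂_of_shortExact {S} hS := by
    rintro ⟨a, ha⟩ ⟨b, hb⟩
    have := hS.mono_f
    refine ⟨a + b + 1, fun U m => ?_⟩
    obtain ⟨k, hk⟩ := exists_app_eq S hS.exact U (fres O (le_top : U ≤ ⊤) t ^ (b + 1) • m)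
      (by rw [map_smul, hb])
    rw [show a + b + 1 + 1 = (a + 1) + (b + 1) by ring, pow_add, mul_smul, ← hk, ← map_smul, ha,
      map_zero]
end

variable (O) in
/-- The abelian category of coherent sheaves on the ringed space `(X, O)`. -/
abbrev Coh := (coherent O).FullSubcategory
variable (O) in
/-- The coherent sheaves `E` with `t ^ (n + 1) E = 0` for some `n`. -/
def cohTorsion (t : Fn O ⊤) : ObjectProperty (Coh O) := (torsion t).inverseImage (coherent O).ι
instance (t : Fn O ⊤) : (cohTorsion O t).IsSerreClass := by
  unfold cohTorsion; infer_instance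
end FormalCoh

namespace SerreQuot

open Triangulated DerivedCategory

universe w v u w' v' u'

variable {C : Type u} [Category.{v} C] [Abelian C]

instance (P : ObjectProperty C) [P.IsSerreClass] : Abelian P.isoModSerre.Localization :=
  ObjectProperty.SerreClassLocalization.abelian P.isoModSerre.Q P

instance (P : ObjectProperty C) [P.IsSerreClass] : PreservesFiniteLimits P.isoModSerre.Q :=
  ObjectProperty.SerreClassLocalization.preservesFiniteLimits P.isoModSerre.Q P
instance (P : ObjectProperty C) [P.IsSerreClass] : PreservesFiniteColimits P.isoModSerre.Q :=
  ObjectProperty.SerreClassLocalization.preservesFiniteColimits P.isoModSerre.Q P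

variable [HasDerivedCategory.{w} C]
variable {D : Type u'} [Category.{v'} D] [Abelian D] [HasDerivedCategory.{w'} D]

/-- The full subcategory of `Dᵇ(C)` of the complexes all of whose cohomology objects belong
to `P`. -/
def cohIn (P : ObjectProperty C) : ObjectProperty (DerivedCategory.Bounded C) :=
  fun E => ∀ n : ℤ, P ((homologyFunctor C n).obj E.obj)

instance (P : ObjectProperty C) [P.IsSerreClass] : (cohIn P).IsClosedUnderIsomorphisms where
  of_iso e h n := P.prop_of_iso ((homologyFunctor C n).mapIso (Bounded.ι.mapIso e)) (h n)

instance (P : ObjectProperty C) [P.IsSerreClass] : (cohIn P).IsTriangulated where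
  exists_zero := ⟨0, isZero_zero _, fun n => P.prop_of_isZero
    (((Bounded.ι ⋙ homologyFunctor C n)).map_isZero (isZero_zero _))⟩
  isStableUnderShiftBy a := ⟨fun E h n =>
    P.prop_of_iso ((homologyFunctor C n).mapIso ((Bounded.ι.commShiftIso a).app E) ≪≫
      ((homologyFunctor C 0).shiftIso a n (a+n) rfl).app E.obj).symm (h (a+n))⟩
  toIsTriangulatedClosed₂ := .mk' (fun T hT h₁ h₃ n => by
    have := (homologyFunctor C n).map_distinguished_exact _ (Bounded.ι.map_distinguished T hT)
    exact P.prop_X₂_of_exact this (h₁ n) (h₃ n))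

/-- The functor `Dᵇ(C) ⥤ Dᵇ(D)` induced by an exact functor `F : C ⥤ D`, which applies `F` to
complexes termwise. -/
def mapBounded (F : C ⥤ D) [F.Additive] [PreservesFiniteLimits F] [PreservesFiniteColimits F] :
    Bounded C ⥤ Bounded D :=
  (TStructure.t (C := D)).bounded.lift (Bounded.ι ⋙ F.mapDerivedCategory) (by
    rintro ⟨X, ⟨a, ha⟩, ⟨b, hb⟩⟩
    obtain ⟨K, _, _, ⟨e⟩⟩ := exists_iso_Q_obj_of_isGE_of_isLE X a b
    let e' := F.mapDerivedCategory.mapIso e ≪≫ F.mapDerivedCategoryFactors.app K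
    refine ⟨⟨a, ⟨_, e', ?_⟩⟩, ⟨b, ⟨_, e', ?_⟩⟩⟩
    · change CochainComplex.IsStrictlyGE ((F.mapHomologicalComplex (ComplexShape.up ℤ)).obj K) a
      infer_instance
    · change CochainComplex.IsStrictlyLE ((F.mapHomologicalComplex (ComplexShape.up ℤ)).obj K) b
      infer_instance)

instance (F : C ⥤ D) [F.Additive] [PreservesFiniteLimits F] [PreservesFiniteColimits F] :
  (mapBounded F).CommShift ℤ := by dsimp only [mapBounded]; infer_instance
instance (F : C ⥤ D) [F.Additive] [PreservesFiniteLimits F] [PreservesFiniteColimits F] :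
  (mapBounded F).IsTriangulated := by dsimp only [mapBounded]; infer_instance

end SerreQuot

namespace FormalDef

/-- `R = ℂ⟦t⟧`; the variable `t` is `PowerSeries.X`. -/
abbrev R : Type := PowerSeries ℂ

/-- The ideal `(t ^ (n + 1))` of `R`. -/
abbrev truncIdeal (n : ℕ) : Ideal R := Ideal.span {(PowerSeries.X : R) ^ (n + 1)}

lemma truncIdeal_le (n : ℕ) : truncIdeal (n + 1) ≤ truncIdeal n :=
  Ideal.span_singleton_le_span_singleton.2 (pow_dvd_pow _ (by omega))

/-- `R_n = ℂ⟦t⟧ ⧸ (t ^ (n + 1)) = ℂ[t] ⧸ (t ^ (n + 1))`. -/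
abbrev Trunc (n : ℕ) : CommRingCat.{0} := .of (R ⧸ truncIdeal n)

/-- The projection `R_{n+1} → R_n`. -/
def truncMap (n : ℕ) : Trunc (n + 1) ⟶ Trunc n :=
  CommRingCat.ofHom (Ideal.Quotient.factor (truncIdeal_le n))

/-- The projection `R → R_n`. -/
def truncProj (n : ℕ) : CommRingCat.of R ⟶ Trunc n :=
  CommRingCat.ofHom (Ideal.Quotient.mk (truncIdeal n))

lemma truncProj_truncMap (n : ℕ) : truncProj (n + 1) ≫ truncMap n = truncProj n := by
  ext x; rfl

/-- A formal deformation over `Spf ℂ⟦t⟧` of the scheme `X` over `ℂ` with structure morphism `f`: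
a smooth and proper formal scheme over `Spf R` with special fibre `X`. It is given by its inductive
system of smooth and proper schemes `π n : level n ⟶ Spec R_n` with
`level n = level (n + 1) ×_{Spec R_{n+1}} Spec R_n`, together with an isomorphism of `ℂ`-schemes
`level 0 ≅ X` (where `R_0 = ℂ`). -/
structure FormalDeformation {X : Scheme.{0}} (f : X ⟶ Spec (.of ℂ)) where
  level : ℕ → Scheme.{0}
  incl (n : ℕ) : level n ⟶ level (n + 1)
  π (n : ℕ) : level n ⟶ Spec (Trunc n)
  isPullback (n : ℕ) : IsPullback (incl n) (π n) (π (n + 1)) (Spec.map (truncMap n))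
  smooth (n : ℕ) : Smooth (π n)
  proper (n : ℕ) : IsProper (π n)
  special : level 0 ≅ X
  special_comp : special.hom ≫ f =
    π 0 ≫ Spec.map (CommRingCat.ofHom (algebraMap ℂ (R ⧸ truncIdeal 0)))

variable {X : Scheme.{0}} {f : X ⟶ Spec (.of ℂ)} (𝒳 : FormalDeformation f)
namespace FormalDeformation

/-- The inductive system `level 0 ⟶ level 1 ⟶ ⋯` of locally ringed spaces. -/
def system : ℕ ⥤ LocallyRingedSpace.{0} :=
  Functor.ofSequence (X := fun n => (𝒳.level n).toLocallyRingedSpace) fun n => (𝒳.incl n).toLRSHom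

/-- The formal scheme itself, as a locally ringed space: the colimit of the thickenings `level n`.
Its topological space is that of `X` and its structure sheaf is the limit of the structure sheaves
of the `level n`. -/
def total : LocallyRingedSpace.{0} := colimit 𝒳.system

lemma incl_comp (n : ℕ) : 𝒳.incl n ≫ 𝒳.π (n + 1) ≫ Spec.map (truncProj (n + 1)) =
    𝒳.π n ≫ Spec.map (truncProj n) := by
  rw [← Category.assoc, (𝒳.isPullback n).w, Category.assoc, ← Spec.map_comp, truncProj_truncMap]

/-- The compatible structure morphisms `level n ⟶ Spec R_n ⟶ Spec R`. -/
def structureCocone : Cocone 𝒳.system where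
  pt := (Spec (.of R)).toLocallyRingedSpace
  ι := NatTrans.ofSequence (fun n => (𝒳.π n ≫ Spec.map (truncProj n)).toLRSHom) (fun n => by
    refine Eq.trans (congrArg (· ≫ (𝒳.π (n + 1) ≫ Spec.map (truncProj (n + 1))).toLRSHom)
      (Functor.ofSequence_map_homOfLE_succ (X := fun n => (𝒳.level n).toLocallyRingedSpace)
        (fun n => (𝒳.incl n).toLRSHom) n)) ?_
    exact (congrArg Scheme.Hom.toLRSHom (𝒳.incl_comp n)).trans (Category.comp_id _).symm)

/-- The structure morphism of the formal scheme, as a morphism to `Spec R`; it makes the structure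
sheaf a sheaf of `R`-algebras. -/
def toSpec : 𝒳.total ⟶ (Spec (.of R)).toLocallyRingedSpace := colimit.desc _ 𝒳.structureCocone

/-- The structure sheaf of the formal scheme. -/
def sheafO : Sheaf (Opens.grothendieckTopology 𝒳.total.toTopCat) RingCat.{0} :=
  (sheafCompose _ (forget₂ CommRingCat RingCat)).obj 𝒳.total.sheaf

/-- The global function `t` on the formal scheme: the image of `t ∈ R`. -/
def t : FormalCoh.Fn 𝒳.sheafO ⊤ :=
  LocallyRingedSpace.Γ.map 𝒳.toSpec.op ((Scheme.ΓSpecIso (.of R)).inv (PowerSeries.X : R))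

/-- `Coh(𝒳)`, the abelian category of coherent sheaves on the formal scheme. -/
abbrev Coh : Type 1 := FormalCoh.Coh 𝒳.sheafO

/-- `Coh(𝒳)₀`, the Serre subcategory of `Coh(𝒳)` of the sheaves `E` such that
`t ^ (n + 1) E = 0` for some `n`. -/
abbrev coh₀ : ObjectProperty 𝒳.Coh := FormalCoh.cohTorsion 𝒳.sheafO 𝒳.t

/-- `Coh(𝒳_K) = Coh(𝒳) ⧸ Coh(𝒳)₀`, the Serre quotient: the localization of `Coh(𝒳)` at the
morphisms whose kernel and cokernel are in `Coh(𝒳)₀`. -/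
abbrev CohK := 𝒳.coh₀.isoModSerre.Localization

instance : HasDerivedCategory 𝒳.Coh := HasDerivedCategory.standard _
instance : HasDerivedCategory 𝒳.CohK := HasDerivedCategory.standard _

/-- `Dᵇ(Coh(𝒳))`. -/
abbrev Db := DerivedCategory.Bounded 𝒳.Coh

/-- `Dᵇ(Coh(𝒳_K))`. -/
abbrev DbK := DerivedCategory.Bounded 𝒳.CohK

/-- `Dᵇ₀(Coh(𝒳))`, the triangulated subcategory of `Dᵇ(Coh(𝒳))` of the complexes with cohomology
in `Coh(𝒳)₀`. -/
abbrev db₀ : ObjectProperty 𝒳.Db := SerreQuot.cohIn 𝒳.coh₀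

/-- The Verdier quotient `Dᵇ(Coh(𝒳)) ⧸ Dᵇ₀(Coh(𝒳))`: the localization of `Dᵇ(Coh(𝒳))` at the
morphisms whose cone is in `Dᵇ₀(Coh(𝒳))`. -/
abbrev VerdierQuotient := 𝒳.db₀.trW.Localization

/-- The quotient functor `Dᵇ(Coh(𝒳)) ⥤ Dᵇ(Coh(𝒳)) ⧸ Dᵇ₀(Coh(𝒳))`. -/
abbrev quotientFunctor : 𝒳.Db ⥤ 𝒳.VerdierQuotient := 𝒳.db₀.trW.Q

/-- The natural exact functor `Q : Dᵇ(Coh(𝒳)) ⥤ Dᵇ(Coh(𝒳_K))`, induced by the exact quotient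
functor `Coh(𝒳) ⥤ Coh(𝒳_K)`. -/
abbrev Q : 𝒳.Db ⥤ 𝒳.DbK := SerreQuot.mapBounded 𝒳.coh₀.isoModSerre.Q

end FormalDeformation

attribute [local instance] MvPolynomial.gradedAlgebra in
/-- `f : X ⟶ Spec ℂ` is projective: `X` is isomorphic over `ℂ` to a closed subscheme of some
projective space `ℙ^N = Proj ℂ[x_0, …, x_N]`. -/
def IsProjectiveOver (f : X ⟶ Spec (.of ℂ)) : Prop :=
  ∃ (N : ℕ) (i : X ⟶ Proj (MvPolynomial.homogeneousSubmodule (Fin (N + 1)) ℂ)),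
    IsClosedImmersion i ∧ f = i ≫ Proj.toSpecZero _ ≫ Spec.map (CommRingCat.ofHom
      (algebraMap ℂ (MvPolynomial.homogeneousSubmodule (Fin (N + 1)) ℂ 0)))

end FormalDef

end

noncomputable section

/-! The argument works for the exact quotient functor `F : C ⥤ D` of any abelian category by a Serre
subcategory `P`. An exact functor commutes with cohomology and `P` is the kernel of `F`, so the
kernel of `mapBounded F` consists exactly of the complexes with cohomology in `P`
(`cohIn_iff_isZero_map`). Hence `mapBounded F` factors through the Verdier quotient.

By `exists_equivalence_of_leftFractions`, the factorization is an equivalence as soon as `mapBounded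
F` is essentially surjective and every `φ : F X ⟶ F Y` has the form `F(s)⁻¹ ∘ F(g)` with `g : X ⟶
Z`, `s : Y ⟶ Z` and `F(s)` invertible. Such fractions give fullness at once; applied to the
retraction of a split monomorphism, they also give faithfulness.

Both conditions come from one statement about honest complexes,
`exists_lift_of_isStrictlyGE_of_isStrictlyLE`: a chain map `F N ⟶ M` of bounded complexes is, up to
an isomorphism of `M`, the image of a chain map `N ⟶ N'`. The complex `N'` is built upwards from a
degree where everything vanishes, clearing denominators in one degree at a time. Taking `N = 0`
gives essential surjectivity. A roof `F K ⟶ M ⟵ F L` in the derived category of `D`, read as a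
single chain map from `F (K ⊞ L)`, gives the fractions. -/

namespace SerreQuot

/-! ### Lifting bounded complexes along a localization of abelian categories -/

section Lifting

universe v v' u u'

variable {C : Type u} [Category.{v} C] [Abelian C] {D : Type u'} [Category.{v'} D] [Abelian D]
  (L : C ⥤ D) [L.Additive] (W : MorphismProperty C)
  [L.IsLocalization W] [W.HasLeftCalculusOfFractions]

include W in
/-- Two morphisms with a common target can be put over a common left denominator. -/
lemma exists_common_leftFraction {X₁ X₂ Y : C} (α : L.obj X₁ ⟶ L.obj Y) (β : L.obj X₂ ⟶ L.obj Y) :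
    ∃ (Y' : C) (s : Y ⟶ Y') (_ : IsIso (L.map s)) (f : X₁ ⟶ Y') (g : X₂ ⟶ Y'),
      L.map f = α ≫ L.map s ∧ L.map g = β ≫ L.map s := by
  -- As `L` is additive, both morphisms are encoded in one morphism out of `L (X₁ ⊞ X₂)`, whose
  -- denominator serves for both.
  obtain ⟨φ, hφ⟩ := Localization.exists_leftFraction L W
    (L.map (biprod.fst : X₁ ⊞ X₂ ⟶ X₁) ≫ α + L.map biprod.snd ≫ β)
  have hs := Localization.inverts L W φ.s φ.hs
  have h : L.map φ.f =
      (L.map (biprod.fst : X₁ ⊞ X₂ ⟶ X₁) ≫ α + L.map biprod.snd ≫ β) ≫ L.map φ.s := by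
    rw [hφ, MorphismProperty.LeftFraction.map_comp_map_s]
  refine ⟨φ.Y', φ.s, hs, biprod.inl ≫ φ.f, biprod.inr ≫ φ.f, ?_, ?_⟩
  · rw [L.map_comp, h, Preadditive.add_comp, Preadditive.comp_add]
    simp only [Category.assoc, ← L.map_comp_assoc]
    simp
  · rw [L.map_comp, h, Preadditive.add_comp, Preadditive.comp_add]
    simp only [Category.assoc, ← L.map_comp_assoc]
    simp

variable {L} in
lemma exists_map_cokernel_desc [PreservesFiniteColimits L] {X Y : C} (d : X ⟶ Y) {Z : D}
    (k : L.obj Y ⟶ Z) (hk : L.map d ≫ k = 0) :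
    ∃ h : L.obj (cokernel d) ⟶ Z, L.map (cokernel.π d) ≫ h = k :=
  ⟨(PreservesCokernel.iso L d).hom ≫ cokernel.desc _ k hk, by simp⟩

variable {L} {N : CochainComplex C ℤ} {M : CochainComplex D ℤ}
  (ψ : ∀ n, L.obj (N.X n) ⟶ M.X n)

/-- A lift to `C` of the object `M.X n` and of the morphism `ψ n`, together with a quotient through
which the differential from `M.X n` factors. -/
structure Stage (n : ℤ) where
  obj : C
  quot : C
  proj : obj ⟶ quot
  iso : L.obj obj ≅ M.X n
  lift : N.X n ⟶ obj
  diff : L.obj quot ⟶ M.X (n + 1)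
  fac : L.map proj ≫ diff = iso.hom ≫ M.d n (n + 1)
  comm : L.map lift ≫ iso.hom = ψ n
  -- This makes the lifted complex obey the same strict bounds as `N` and `M`.
  isZero : IsZero (N.X n) → IsZero (M.X n) → IsZero obj

variable {ψ}

/-- The stage `s'` continues the stage `s`. -/
def Stage.Rel {n : ℤ} (s : Stage ψ n) (s' : Stage ψ (n + 1)) : Prop :=
  ∃ m : s.quot ⟶ s'.obj, (s.proj ≫ m) ≫ s'.proj = 0 ∧
    L.map (s.proj ≫ m) ≫ s'.iso.hom = s.iso.hom ≫ M.d n (n + 1) ∧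
    N.d n (n + 1) ≫ s'.lift = s.lift ≫ s.proj ≫ m

lemma Stage.exists_of_isZero {n : ℤ} (hN : IsZero (N.X n)) (hM : IsZero (M.X n)) :
    Nonempty (Stage ψ n) :=
  ⟨{ obj := 0
     quot := 0
     proj := 0
     iso := (L.map_isZero (isZero_zero C)).iso hM
     lift := 0
     diff := 0
     fac := (L.map_isZero (isZero_zero C)).eq_of_src _ _
     comm := (L.map_isZero hN).eq_of_src _ _
     isZero := fun _ _ => isZero_zero C }⟩

lemma Stage.rel_of_isZero {n : ℤ} (hN : IsZero (N.X n)) (hM : IsZero (M.X n))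
    (s : Stage ψ n) (s' : Stage ψ (n + 1)) : s.Rel s' :=
  ⟨0, by simp, (L.map_isZero (s.isZero hN hM)).eq_of_src _ _, hN.eq_of_src _ _⟩

-- The next differential is required to start from `s.quot`, the stored quotient of `s.obj`, so that
-- its composite with the previous one vanishes in `C` and not just after applying `L`. Clearing
-- denominators for this differential and for the next component of `ψ` at once produces a candidate
-- object. The square with `N.d` then commutes only in `D`, and one more denominator makes it
-- commute in `C`.
include W in
lemma Stage.exists_rel [PreservesFiniteColimits L]
    (hψ : ∀ n, L.map (N.d n (n + 1)) ≫ ψ (n + 1) = ψ n ≫ M.d n (n + 1))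
    {n : ℤ} (s : Stage ψ n) : ∃ s' : Stage ψ (n + 1), s.Rel s' := by
  -- In this case the object must be chosen to be zero: clearing denominators could give a nonzero
  -- object killed by `L`.
  by_cases hz : IsZero (N.X (n + 1)) ∧ IsZero (M.X (n + 1))
  · obtain ⟨hN, hM⟩ := hz
    obtain ⟨s'⟩ := Stage.exists_of_isZero (ψ := ψ) hN hM
    have h0 := s'.isZero hN hM
    exact ⟨s', 0, by simp, hM.eq_of_tgt _ _, h0.eq_of_tgt _ _⟩
  have := Localization.essSurj L W
  let e₀ := L.objObjPreimageIso (M.X (n + 1))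
  obtain ⟨Y, t, ht, m, g, hm, hg⟩ := exists_common_leftFraction L W
    (s.diff ≫ e₀.inv) (ψ (n + 1) ≫ e₀.inv)
  have hdef : L.map (N.d n (n + 1) ≫ g) = L.map (s.lift ≫ s.proj ≫ m) := by
    simp only [L.map_comp, hg, hm, ← Category.assoc, cancel_mono]
    rw [hψ, ← s.comm]
    simp only [Category.assoc, s.fac]
  -- Two morphisms with the same image under `L` agree after composition with some `r` in `W`, so
  -- `Y` is replaced by the target of `r`.
  obtain ⟨Y', r, hr, hrr⟩ := (MorphismProperty.map_eq_iff_postcomp L W _ _).1 hdef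
  have hr' := Localization.inverts L W r hr
  let e : L.obj Y' ≅ M.X (n + 1) := (asIso (L.map t ≫ L.map r)).symm ≪≫ e₀
  have hd : L.map (s.proj ≫ m ≫ r) ≫ e.hom = s.iso.hom ≫ M.d n (n + 1) := by
    simp [e, hm, ← s.fac]
  -- Right exactness of `L` and `d ≫ d = 0` in `M` let the following differential of `M` descend to
  -- the cokernel, which becomes the new `quot`.
  obtain ⟨h, hh⟩ := exists_map_cokernel_desc (s.proj ≫ m ≫ r)
    (e.hom ≫ M.d (n + 1) (n + 1 + 1)) (by rw [reassoc_of% hd]; simp)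
  exact ⟨{ obj := Y'
           quot := cokernel (s.proj ≫ m ≫ r)
           proj := cokernel.π _
           iso := e
           lift := g ≫ r
           diff := h
           fac := hh
           comm := by simp [e, hg]
           isZero := fun h₁ h₂ => (hz ⟨h₁, h₂⟩).elim },
    m ≫ r, cokernel.condition _, hd, by simpa using hrr⟩

include W in
lemma Stage.exists_family [PreservesFiniteColimits L]
    (hψ : ∀ n, L.map (N.d n (n + 1)) ≫ ψ (n + 1) = ψ n ≫ M.d n (n + 1)) (a : ℤ)
    (hN : ∀ i < a, IsZero (N.X i)) (hM : ∀ i < a, IsZero (M.X i)) :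
    ∃ s : ∀ n, Stage ψ n, ∀ n, (s n).Rel (s (n + 1)) := by
  choose next hnext using fun (n : ℤ) (s : Stage ψ n) => s.exists_rel W hψ
  -- The recursion starts in degree `a - 1`, where both complexes vanish. Below it any stage will
  -- do, since its object is zero.
  let s : ∀ n, Stage ψ n := fun n => n.inductionOn' (motive := Stage ψ) (a - 1)
    (Stage.exists_of_isZero (hN _ (by lia)) (hM _ (by lia))).some
    (fun k _ s => next k s)
    (fun k hk _ => (Stage.exists_of_isZero (hN _ (by lia)) (hM _ (by lia))).some)
  refine ⟨s, fun n => ?_⟩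
  by_cases hn : a - 1 ≤ n
  · have : s (n + 1) = next n (s n) := Int.inductionOn'_add_one hn
    rw [this]
    exact hnext _ _
  · exact Stage.rel_of_isZero (hN _ (by lia)) (hM _ (by lia)) _ _

variable (L) in
include W in
/-- A morphism from (the image of) a bounded complex of `C` to a bounded complex of a localization
of `C` lifts to a morphism of bounded complexes of `C`. -/
lemma exists_lift_of_isStrictlyGE_of_isStrictlyLE [PreservesFiniteColimits L]
    (N : CochainComplex C ℤ) (M : CochainComplex D ℤ)
    (ψ : (L.mapHomologicalComplex (ComplexShape.up ℤ)).obj N ⟶ M) (a b : ℤ)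
    [N.IsStrictlyGE a] [N.IsStrictlyLE b] [M.IsStrictlyGE a] [M.IsStrictlyLE b] :
    ∃ (N' : CochainComplex C ℤ) (_ : N'.IsStrictlyGE a) (_ : N'.IsStrictlyLE b) (g : N ⟶ N')
      (e : (L.mapHomologicalComplex (ComplexShape.up ℤ)).obj N' ≅ M),
      (L.mapHomologicalComplex (ComplexShape.up ℤ)).map g ≫ e.hom = ψ := by
  have hψ (n : ℤ) : L.map (N.d n (n + 1)) ≫ ψ.f (n + 1) = ψ.f n ≫ M.d n (n + 1) :=
    (ψ.comm n (n + 1)).symm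
  obtain ⟨s, hs⟩ := Stage.exists_family W hψ a
    (fun i hi => N.isZero_of_isStrictlyGE a i hi) (fun i hi => M.isZero_of_isStrictlyGE a i hi)
  choose m hm hd hg using hs
  let N' : CochainComplex C ℤ := CochainComplex.of (fun n => (s n).obj)
    (fun n => (s n).proj ≫ m n) (fun n => by
      rw [← Category.assoc, hm, zero_comp])
  have hN'd (n : ℤ) : N'.d n (n + 1) = (s n).proj ≫ m n :=
    CochainComplex.of_d (fun n => (s n).obj) (fun n => (s n).proj ≫ m n) n
  refine ⟨N', ?_, ?_, ?_, ?_, ?_⟩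
  · rw [CochainComplex.isStrictlyGE_iff]
    exact fun i hi => (s i).isZero (N.isZero_of_isStrictlyGE a i hi)
      (M.isZero_of_isStrictlyGE a i hi)
  · rw [CochainComplex.isStrictlyLE_iff]
    exact fun i hi => (s i).isZero (N.isZero_of_isStrictlyLE b i hi)
      (M.isZero_of_isStrictlyLE b i hi)
  · exact { f := fun n => (s n).lift
            comm' := by
              rintro i _ rfl
              rw [hN'd]
              exact (hg i).symm }
  · exact HomologicalComplex.Hom.isoOfComponents (fun n => (s n).iso) (by
      rintro i _ rfl
      change _ = L.map (N'.d i (i + 1)) ≫ _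
      rw [hN'd]
      exact (hd i).symm)
  · ext n
    exact (s n).comm

end Lifting

/-! ### A criterion for a triangulated functor to be a Verdier quotient -/

section Triangulated

open Pretriangulated

universe v v' u u'

variable {C : Type u} [Category.{v} C] [HasZeroObject C] [HasShift C ℤ] [Preadditive C]
  [∀ n : ℤ, (shiftFunctor C n).Additive] [Pretriangulated C]
  {D : Type u'} [Category.{v'} D] [HasZeroObject D] [HasShift D ℤ] [Preadditive D]
  [∀ n : ℤ, (shiftFunctor D n).Additive] [Pretriangulated D]
  (P : ObjectProperty C) (F : C ⥤ D) [F.CommShift ℤ] [F.IsTriangulated]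

-- A triangulated functor inverts a morphism exactly when it kills its cone.
variable {P F} in
lemma trW_iff_isIso_map (hP : ∀ X, P X ↔ IsZero (F.obj X)) {X Y : C} (f : X ⟶ Y) :
    P.trW f ↔ IsIso (F.map f) := by
  obtain ⟨Z, g, h, hT⟩ := distinguished_cocone_triangle f
  have : P.IsClosedUnderIsomorphisms :=
    ⟨fun e hX => (hP _).2 (((hP _).1 hX).of_iso (F.mapIso e).symm)⟩
  exact (P.trW_iff_of_distinguished _ hT).trans
    ((hP Z).trans (Triangle.isZero₃_iff_isIso₁ _ (F.map_distinguished _ hT)))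

variable [IsTriangulated C] [P.IsTriangulated]

/-- A triangulated functor `F` with kernel `P` which is essentially surjective and such that
morphisms between objects in the image of `F` are left fractions of morphisms in the image of `F`
identifies its target with the Verdier quotient by `P`. -/
theorem exists_equivalence_of_leftFractions [F.EssSurj]
    (hP : ∀ X, P X ↔ IsZero (F.obj X))
    (hF : ∀ ⦃X Y : C⦄ (φ : F.obj X ⟶ F.obj Y), ∃ (Z : C) (g : X ⟶ Z) (s : Y ⟶ Z),
      IsIso (F.map s) ∧ F.map g = φ ≫ F.map s) :
    ∃ (Φ : P.trW.Localization ⥤ D) (_ : Φ.CommShift ℤ) (e : P.trW.Q ⋙ Φ ≅ F),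
      NatTrans.CommShift e.hom ℤ ∧ Φ.IsTriangulated ∧ Φ.IsEquivalence := by
  have hW {X Y : C} (f : X ⟶ Y) : P.trW f ↔ IsIso (F.map f) := trW_iff_isIso_map hP f
  have hinv : P.trW.IsInvertedBy F := fun X Y f hf => (hW f).1 hf
  let Φ := Localization.lift F hinv P.trW.Q
  let : Φ.CommShift ℤ := Functor.commShiftOfLocalization P.trW.Q P.trW ℤ F Φ
  let e : P.trW.Q ⋙ Φ ≅ F := Localization.Lifting.iso P.trW.Q P.trW F Φ
  have he : NatTrans.CommShift e.hom ℤ :=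
    NatTrans.commShift_iso_hom_of_localization P.trW.Q P.trW ℤ F Φ
  -- Every morphism of the quotient is, up to isomorphism, the image of a morphism of `C`; this is
  -- what allows `Φ` to inherit exactness from `F`.
  have := Localization.essSurj_mapArrow P.trW.Q P.trW
  have := Localization.essSurj P.trW.Q P.trW
  have hΦ : Φ.IsTriangulated := Functor.isTriangulated_of_precomp_iso e
  have hnat {X Y : C} (f : X ⟶ Y) :
      Φ.map (P.trW.Q.map f) = e.hom.app X ≫ F.map f ≫ e.inv.app Y := by
    rw [← Category.assoc]
    exact (Iso.eq_comp_inv (e.app Y)).2 (e.hom.naturality f)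
  have zero_of_map {X Y : C} (f : X ⟶ Y) (hf : F.map f = 0) : P.trW.Q.map f = 0 := by
    obtain ⟨Z, g, h, hT⟩ := distinguished_cocone_triangle f
    -- Since `F f = 0`, the morphism from `F Y` to the cone is split mono. Writing its retraction
    -- `r` as a fraction `F(s)⁻¹ ∘ F(a)` gives `F (g ≫ a) = F s`, so `g ≫ a` becomes invertible in
    -- the Verdier quotient; as `f ≫ g = 0`, the image of `f` there is zero.
    obtain ⟨r, hr⟩ : ∃ r : F.obj Z ⟶ F.obj Y, 𝟙 (F.obj Y) = F.map g ≫ r :=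
      Triangle.yoneda_exact₂ _ (F.map_distinguished _ hT) (𝟙 (F.obj Y))
        ((congrArg (· ≫ 𝟙 (F.obj Y)) hf).trans zero_comp)
    obtain ⟨G, a, s, hs, has⟩ := hF r
    have hga : F.map (g ≫ a) = F.map s := by
      rw [F.map_comp, has, ← Category.assoc, ← hr, Category.id_comp]
    have : IsIso (P.trW.Q.map (g ≫ a)) :=
      Localization.inverts P.trW.Q P.trW _ ((hW _).2 (by rw [hga]; exact hs))
    have hfg : f ≫ g = 0 := comp_distTriang_mor_zero₁₂ _ hT
    rw [← cancel_mono (P.trW.Q.map (g ≫ a)), ← P.trW.Q.map_comp, reassoc_of% hfg]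
    simp
  have : Φ.Faithful :=
    Functor.faithful_of_comp_cancel_zero_of_hasLeftCalculusOfFractions P.trW.Q P.trW Φ
      fun X Y f hf => zero_of_map f (by
        have h := e.hom.naturality f
        rw [Functor.comp_map, hf, zero_comp] at h
        rw [← cancel_epi (e.hom.app X), ← h, comp_zero])
  have : Φ.Full := Φ.full_of_comp_essSurj P.trW.Q fun X Y φ => by
    obtain ⟨Z, g, s, hs, hgs⟩ := hF (e.inv.app X ≫ φ ≫ e.hom.app Y)
    have : IsIso (P.trW.Q.map s) := Localization.inverts P.trW.Q P.trW s ((hW s).2 hs)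
    refine ⟨P.trW.Q.map g ≫ inv (P.trW.Q.map s), ?_⟩
    rw [Functor.map_comp, Functor.map_inv, IsIso.comp_inv_eq, hnat, hnat, hgs]
    simp
  have : Φ.EssSurj :=
    ⟨fun Y => ⟨P.trW.Q.obj (F.objPreimage Y), ⟨e.app _ ≪≫ F.objObjPreimageIso Y⟩⟩⟩
  exact ⟨Φ, inferInstance, e, he, hΦ, { }⟩

end Triangulated

/-! ### Application to bounded derived categories -/

open DerivedCategory

universe w v u w' v' u'

variable {C : Type u} [Category.{v} C] [Abelian C] [HasDerivedCategory.{w} C]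
  {D : Type u'} [Category.{v'} D] [Abelian D] [HasDerivedCategory.{w'} D]

/-- A bounded complex, as an object of the bounded derived category. -/
def boundedObj (K : CochainComplex C ℤ) (a b : ℤ) [K.IsStrictlyGE a] [K.IsStrictlyLE b] :
    Bounded C :=
  ⟨Q.obj K, ⟨a, ⟨K, Iso.refl _, inferInstance⟩⟩, ⟨b, ⟨K, Iso.refl _, inferInstance⟩⟩⟩

/-- The bounds may be enlarged at will, so that two objects can be represented by complexes in a
common range of degrees. -/
lemma exists_iso_boundedObj (E : Bounded C) :
    ∃ a₀ b₀ : ℤ, ∀ a ≤ a₀, ∀ b, b₀ ≤ b →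
      ∃ (K : CochainComplex C ℤ) (_ : K.IsStrictlyGE a) (_ : K.IsStrictlyLE b),
        Nonempty (E ≅ boundedObj K a b) := by
  obtain ⟨X, ⟨a₀, ha⟩, ⟨b₀, hb⟩⟩ := E
  obtain ⟨K, _, _, ⟨e⟩⟩ := exists_iso_Q_obj_of_isGE_of_isLE X a₀ b₀
  refine ⟨a₀, b₀, fun a ha' b hb' => ⟨K, K.isStrictlyGE_of_ge a a₀ ha',
    K.isStrictlyLE_of_le b₀ b hb', ⟨ObjectProperty.isoMk _ e⟩⟩⟩

variable (F : C ⥤ D) [F.Additive] [PreservesFiniteLimits F] [PreservesFiniteColimits F]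

variable (W : MorphismProperty C) [F.IsLocalization W] [W.HasLeftCalculusOfFractions]

-- Lifting the zero map `F 0 ⟶ M` lifts the complex `M` itself.
include W in
lemma essSurj_mapBounded : (mapBounded F).EssSurj where
  mem_essImage E := by
    obtain ⟨a, b, h⟩ := exists_iso_boundedObj E
    obtain ⟨M, _, _, ⟨e⟩⟩ := h a le_rfl b le_rfl
    have : (0 : CochainComplex C ℤ).IsStrictlyGE a := by
      rw [CochainComplex.isStrictlyGE_iff]
      exact fun i _ => (HomologicalComplex.eval C _ i).map_isZero (isZero_zero _)
    have : (0 : CochainComplex C ℤ).IsStrictlyLE b := by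
      rw [CochainComplex.isStrictlyLE_iff]
      exact fun i _ => (HomologicalComplex.eval C _ i).map_isZero (isZero_zero _)
    obtain ⟨N, _, _, -, e', -⟩ := exists_lift_of_isStrictlyGE_of_isStrictlyLE F W 0 M 0 a b
    let i : (mapBounded F).obj (boundedObj N a b) ≅ boundedObj M a b :=
      ObjectProperty.isoMk _ (F.mapDerivedCategoryFactors.app N ≪≫ Q.mapIso e')
    exact ⟨boundedObj N a b, ⟨i ≪≫ e.symm⟩⟩

-- Numerator and denominator of a roof in the derived category of `D` are lifted simultaneously. The
-- resulting `s` need not be a quasi-isomorphism in `C`; only its image under `F` is one.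
include W in
lemma exists_leftFraction_mapDerivedCategory (K L : CochainComplex C ℤ) (a b : ℤ)
    [K.IsStrictlyGE a] [K.IsStrictlyLE b] [L.IsStrictlyGE a] [L.IsStrictlyLE b]
    (φ : F.mapDerivedCategory.obj (Q.obj K) ⟶ F.mapDerivedCategory.obj (Q.obj L)) :
    ∃ (N : CochainComplex C ℤ) (_ : N.IsStrictlyGE a) (_ : N.IsStrictlyLE b)
      (g : K ⟶ N) (s : L ⟶ N), IsIso (F.mapDerivedCategory.map (Q.map s)) ∧
        F.mapDerivedCategory.map (Q.map g) = φ ≫ F.mapDerivedCategory.map (Q.map s) := by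
  let G : CochainComplex C ℤ ⥤ CochainComplex D ℤ := F.mapHomologicalComplex (ComplexShape.up ℤ)
  let α (K' : CochainComplex C ℤ) : F.mapDerivedCategory.obj (Q.obj K') ≅ Q.obj (G.obj K') :=
    F.mapDerivedCategoryFactors.app K'
  -- The middle term `M` of the roof can be taken strictly within `[a, b]`, as the lifting of
  -- complexes requires.
  obtain ⟨M, _, _, k, l, hl, hkl⟩ := left_fac_of_isStrictlyLE_of_isStrictlyGE (X := G.obj K)
    (Y := G.obj L) a b ((α K).inv ≫ φ ≫ (α L).hom)
  have hKL (i : ℤ) (hK : IsZero (K.X i)) (hL : IsZero (L.X i)) : IsZero ((K ⊞ L).X i) :=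
    ((biprod_isZero_iff _ _).2 ⟨hK, hL⟩).of_iso (HomologicalComplex.biprodXIso K L i)
  have : (K ⊞ L).IsStrictlyGE a := by
    rw [CochainComplex.isStrictlyGE_iff]
    exact fun i hi => hKL i (K.isZero_of_isStrictlyGE a i hi) (L.isZero_of_isStrictlyGE a i hi)
  have : (K ⊞ L).IsStrictlyLE b := by
    rw [CochainComplex.isStrictlyLE_iff]
    exact fun i hi => hKL i (K.isZero_of_isStrictlyLE b i hi) (L.isZero_of_isStrictlyLE b i hi)
  -- Lifting from the direct sum gives `k` and `l` lifts with the same target `N`.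
  obtain ⟨N, hNa, hNb, f, e, hf⟩ := exists_lift_of_isStrictlyGE_of_isStrictlyLE F W (K ⊞ L) M
    (G.map biprod.fst ≫ k + G.map biprod.snd ≫ l) a b
  have hk : G.map (biprod.inl ≫ f) ≫ e.hom = k := by
    rw [G.map_comp, Category.assoc, hf, Preadditive.comp_add, ← G.map_comp_assoc,
      ← G.map_comp_assoc]
    simp
  have hl' : G.map (biprod.inr ≫ f) ≫ e.hom = l := by
    rw [G.map_comp, Category.assoc, hf, Preadditive.comp_add, ← G.map_comp_assoc,
      ← G.map_comp_assoc]
    simp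
  have hα {K' : CochainComplex C ℤ} (u : K' ⟶ N) {v : G.obj K' ⟶ M} (h : G.map u ≫ e.hom = v) :
      F.mapDerivedCategory.map (Q.map u) = (α K').hom ≫ Q.map v ≫ Q.map e.inv ≫ (α N).inv := by
    have h₁ : F.mapDerivedCategory.map (Q.map u) ≫ (α N).hom = (α K').hom ≫ Q.map (G.map u) :=
      F.mapDerivedCategoryFactors.hom.naturality u
    have h₂ : G.map u = v ≫ e.inv := (Iso.eq_comp_inv e).2 h
    rw [← Q.map_comp_assoc, ← h₂, ← Category.assoc, Iso.eq_comp_inv, h₁]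
  refine ⟨N, hNa, hNb, biprod.inl ≫ f, biprod.inr ≫ f, ?_, ?_⟩
  · rw [hα _ hl']
    infer_instance
  · rw [IsIso.eq_comp_inv] at hkl
    rw [hα _ hl', hα _ hk, ← hkl]
    simp

include W in
lemma exists_leftFraction_mapBounded {X Y : Bounded C}
    (φ : (mapBounded F).obj X ⟶ (mapBounded F).obj Y) :
    ∃ (Z : Bounded C) (g : X ⟶ Z) (s : Y ⟶ Z),
      IsIso ((mapBounded F).map s) ∧ (mapBounded F).map g = φ ≫ (mapBounded F).map s := by
  obtain ⟨a₁, b₁, hX⟩ := exists_iso_boundedObj X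
  obtain ⟨a₂, b₂, hY⟩ := exists_iso_boundedObj Y
  obtain ⟨K, _, _, ⟨eK⟩⟩ := hX (min a₁ a₂) (min_le_left _ _) (max b₁ b₂) (le_max_left _ _)
  obtain ⟨L, _, _, ⟨eL⟩⟩ := hY (min a₁ a₂) (min_le_right _ _) (max b₁ b₂) (le_max_right _ _)
  obtain ⟨N, _, _, g, s, hs, hgs⟩ := exists_leftFraction_mapDerivedCategory F W K L
    (min a₁ a₂) (max b₁ b₂)
    (((mapBounded F).map eK.inv).hom ≫ φ.hom ≫ ((mapBounded F).map eL.hom).hom)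
  let g' : boundedObj K (min a₁ a₂) (max b₁ b₂) ⟶ boundedObj N (min a₁ a₂) (max b₁ b₂) :=
    ObjectProperty.homMk (Q.map g)
  let s' : boundedObj L (min a₁ a₂) (max b₁ b₂) ⟶ boundedObj N (min a₁ a₂) (max b₁ b₂) :=
    ObjectProperty.homMk (Q.map s)
  have hgs' : (mapBounded F).map g' =
      ((mapBounded F).map eK.inv ≫ φ ≫ (mapBounded F).map eL.hom) ≫ (mapBounded F).map s' :=
    ObjectProperty.hom_ext _ hgs
  have hs' : IsIso ((mapBounded F).map s') := 
    (ObjectProperty.isoMk _ (@asIso _ _ _ _ _ hs)).isIso_hom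
  refine ⟨_, eK.hom ≫ g', eL.hom ≫ s', ?_, ?_⟩
  · rw [Functor.map_comp]
    infer_instance
  · simp [hgs', ← Functor.map_comp_assoc]

lemma isZero_iff_isZero_homology (X : DerivedCategory D) :
    IsZero X ↔ ∀ n, IsZero ((homologyFunctor D n).obj X) := by
  refine ⟨fun h n => Functor.map_isZero _ h, fun h => ?_⟩
  have : IsIso (0 : X ⟶ 0) := (DerivedCategory.isIso_iff _ _).2 fun n =>
    (h n).isIso (Functor.map_isZero _ (isZero_zero _)) _
  exact (isZero_zero _).of_iso (asIso (0 : X ⟶ 0))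

/-- The functor on derived categories induced by an exact functor commutes with homology. -/
lemma nonempty_homology_mapDerivedCategory_iso (X : DerivedCategory C) (n : ℤ) :
    Nonempty ((homologyFunctor D n).obj (F.mapDerivedCategory.obj X) ≅
      F.obj ((homologyFunctor C n).obj X)) := by
  let K := Q.objPreimage X
  let e : Q.obj K ≅ X := Q.objObjPreimageIso X
  exact ⟨(homologyFunctor D n).mapIso
      (F.mapDerivedCategory.mapIso e.symm ≪≫ F.mapDerivedCategoryFactors.app K) ≪≫
    (homologyFunctorFactors D n).app _ ≪≫ (K.sc n).mapHomologyIso F ≪≫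
    F.mapIso (((homologyFunctorFactors C n).app K).symm ≪≫ (homologyFunctor C n).mapIso e)⟩

/-- Vanishing in the derived category is detected on cohomology, and the cohomology of the image of
`E` is `F` applied to that of `E`. -/
lemma cohIn_iff_isZero_map (P : ObjectProperty C) (hP : ∀ X, P X ↔ IsZero (F.obj X))
    (E : Bounded C) : cohIn P E ↔ IsZero ((mapBounded F).obj E) := by
  have h₁ : IsZero ((mapBounded F).obj E) ↔ IsZero (F.mapDerivedCategory.obj E.obj) :=
    ⟨fun h => Bounded.ι.map_isZero h, fun h => by
      rw [IsZero.iff_id_eq_zero]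
      exact ObjectProperty.hom_ext _ (h.eq_of_src _ _)⟩
  rw [h₁, isZero_iff_isZero_homology]
  exact forall_congr' fun n => (hP _).trans
    (nonempty_homology_mapDerivedCategory_iso F E.obj n).some.isZero_iff.symm

/-- If `F : C ⥤ D` is the quotient of an abelian category by a Serre subcategory `P`, the bounded
derived category of `D` is the Verdier quotient of that of `C` by the complexes with cohomology
in `P`. -/
theorem exists_equivalence_mapBounded (P : ObjectProperty C) [P.IsSerreClass]
    [F.IsLocalization P.isoModSerre] :
    ∃ (Φ : (cohIn P).trW.Localization ⥤ Bounded D) (_ : Φ.CommShift ℤ)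
      (e : (cohIn P).trW.Q ⋙ Φ ≅ mapBounded F),
      NatTrans.CommShift e.hom ℤ ∧ Φ.IsTriangulated ∧ Φ.IsEquivalence := by
  have := essSurj_mapBounded F P.isoModSerre
  exact exists_equivalence_of_leftFractions (cohIn P) (mapBounded F)
    (cohIn_iff_isZero_map F P
      fun X => (ObjectProperty.SerreClassLocalization.isZero_obj_iff F P X).symm)
    fun X Y φ => exists_leftFraction_mapBounded F P.isoModSerre φ

end SerreQuot

theorem proposition3p6 (X : Scheme.{0}) (f : X ⟶ Spec (.of ℂ)) [IsIntegral X] [Smooth f]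
    (hf : FormalDef.IsProjectiveOver f) (𝒳 : FormalDef.FormalDeformation f) :
    ∃ (Φ : 𝒳.VerdierQuotient ⥤ 𝒳.DbK) (_ : Φ.CommShift ℤ)
      (e : 𝒳.quotientFunctor ⋙ Φ ≅ 𝒳.Q),
      NatTrans.CommShift e.hom ℤ ∧ Φ.IsTriangulated ∧ Φ.IsEquivalence :=
  SerreQuot.exists_equivalence_mapBounded 𝒳.coh₀.isoModSerre.Q 𝒳.coh₀
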